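/- Let $\mathbb{M}_n$ be the space of complex $n\times n$ matrices, let $[a,b]\subset\mathbb{R}$, let $f,g$ be nonnegative real functions on $[a,b]$, and let $A,B\in\mathbb{M}_n$ be Hermitian with spectra in $[a,b]$. Let $X,Y\in\mathbb{M}_n$ satisfy $X^*X+Y^*Y=XX^*+YY^*=I$. Write $S\oplus T\in\mathbb{M}_{2n}$ for the block diagonal matrix with diagonal blocks $S,T$, and let $f(Z)$, $g(Z)$ be defined by the functional calculus for Hermitian $Z$. (i) If $f$ is concave on $[a,b]$, then for every symmetric antinorm $\|\cdot\|_!$ on the cone $\mathbb{M}_{2n}^+$ of positive semidefinite matrices, $$\left\| f(X^*AX+Y^*BY)\oplus f(Y^*AY+X^*BX)\right\|_!\ \ge\ \left\|f(A\oplus B)\right\|_! .$$ (ii) If $g$ is convex on $[a,b]$, then for every symmetric norm $\|\cdot\|$ on $\mathbb{M}_{2n}$, $$\left\| g(X^*AX+Y^*BY)\oplus g(Y^*AY+X^*BX)\right\|\ \le\ \left\|g(A\oplus B)\right\| .$$ Here a symmetric norm is a norm on $\mathbb{M}_{2n}$ with $\|UZV\|=\|Z\|$ for all $Z$ and all unitary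 $U,V$. A symmetric antinorm is a functional $\|\cdot\|_!:\mathbb{M}_{2n}^+\to[0,\infty)$ with $\|cZ\|_!=c\|Z\|_!$ for real $c\ge 0$, $\|Z+W\|_!\ge\|Z\|_!+\|W\|_!$ for all $Z,W\in\mathbb{M}_{2n}^+$, and $\|UZU^*\|_!=\|Z\|_!$ for all unitary $U$ (continuity is not required). -/

import Mathlib

open scoped Matrix ComplexOrder

/-- A symmetric (unitarily invariant) norm on the space of complex square matrices indexed by `m`:
a norm, i.e. a seminorm vanishing only at `0`, with `p (U * A * V) = p A` for all unitary
`U`, `V`. -/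
structure IsSymmetricNorm {m : Type*} [Fintype m] [DecidableEq m]
    (p : Seminorm ℂ (Matrix m m ℂ)) : Prop where
  eq_zero : ∀ A : Matrix m m ℂ, p A = 0 → A = 0
  unitarily_invariant : ∀ A : Matrix m m ℂ,
    ∀ U ∈ Matrix.unitaryGroup m ℂ, ∀ V ∈ Matrix.unitaryGroup m ℂ, p (U * A * V) = p A

/-- A symmetric antinorm on the cone of positive semidefinite complex matrices indexed by `m`:
a nonnegative, positively homogeneous, superadditive (equivalently, concave) functional that is
invariant under unitary congruence. Only the values of `N` on the cone matter. Some authors also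
ask for continuity on the cone; it is not required here, so that the class is the larger one. -/
structure IsSymmetricAntinorm {m : Type*} [Fintype m] [DecidableEq m]
    (N : Matrix m m ℂ → ℝ) : Prop where
  nonneg : ∀ A : Matrix m m ℂ, A.PosSemidef → 0 ≤ N A
  homogeneous : ∀ (c : ℝ) (A : Matrix m m ℂ), 0 ≤ c → A.PosSemidef → N (c • A) = c * N A
  superadditive : ∀ A B : Matrix m m ℂ, A.PosSemidef → B.PosSemidef → N A + N B ≤ N (A + B)
  unitarily_invariant : ∀ A : Matrix m m ℂ, A.PosSemidef →
    ∀ U ∈ Matrix.unitaryGroup m ℂ, N (U * A * Uᴴ) = N A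

/-! With K = X ⊕ X and L the off-diagonal block matrix with both corners Y, the map Z ↦ KᴴZK + LᴴZL
sends A ⊕ B to the block matrix on the other side. The hypotheses on X, Y make it unital and trace
preserving, so between eigenbases it acts on eigenvalues by a doubly stochastic matrix. By
Birkhoff's theorem the new eigenvalue vector is a convex combination of permutations of the old one
(`exists_perm_weights_of_kraus_eq`). Unitary invariance reduces both claims to diagonal matrices.
There scalar Jensen applies entrywise, monotonicity transfers it to the (anti)norm, and
superadditivity or the triangle inequality splits the combination into permuted terms of equal
value. -/

namespace Matrix

variable {m : Type*} [DecidableEq m]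

/-- The complex diagonal matrix with prescribed real diagonal entries. -/
noncomputable def realDiagonal (d : m → ℝ) : Matrix m m ℂ := diagonal fun i => (d i : ℂ)

lemma realDiagonal_add (d e : m → ℝ) :
    realDiagonal (d + e) = realDiagonal d + realDiagonal e := by
  simp [realDiagonal, diagonal_add]

lemma realDiagonal_smul (c : ℝ) (d : m → ℝ) : realDiagonal (c • d) = c • realDiagonal d := by
  ext i j
  by_cases h : i = j <;> simp [realDiagonal, h]

lemma realDiagonal_sum {ι : Type*} (s : Finset ι) (d : ι → m → ℝ) :
    realDiagonal (∑ k ∈ s, d k) = ∑ k ∈ s, realDiagonal (d k) := by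
  classical
  induction s using Finset.induction_on with
  | empty => simp [realDiagonal]
  | insert k s hk ih => rw [Finset.sum_insert hk, Finset.sum_insert hk, realDiagonal_add, ih]

lemma realDiagonal_posSemidef {d : m → ℝ} (hd : ∀ i, 0 ≤ d i) : (realDiagonal d).PosSemidef := by
  exact PosSemidef.diagonal fun i => Complex.zero_le_real.2 (hd i)

variable [Fintype m]

lemma mem_unitaryGroup_of_conjTranspose_mul {U : Matrix m m ℂ} (h : Uᴴ * U = 1) :
    U ∈ unitaryGroup m ℂ := mem_unitaryGroup_iff'.2 h

lemma conjTranspose_mul_of_mem_unitaryGroup {U : Matrix m m ℂ} (h : U ∈ unitaryGroup m ℂ) :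
    Uᴴ * U = 1 := mem_unitaryGroup_iff'.1 h

lemma mul_conjTranspose_of_mem_unitaryGroup {U : Matrix m m ℂ} (h : U ∈ unitaryGroup m ℂ) :
    U * Uᴴ = 1 := mem_unitaryGroup_iff.1 h

lemma conjTranspose_mem_unitaryGroup {U : Matrix m m ℂ} (h : U ∈ unitaryGroup m ℂ) :
    Uᴴ ∈ unitaryGroup m ℂ := Unitary.star_mem h

/-! ### Diagonalization and functional calculus -/

lemma IsHermitian.exists_unitary_conj_realDiagonal {A : Matrix m m ℂ} (hA : A.IsHermitian) :
    ∃ U ∈ unitaryGroup m ℂ, ∃ d : m → ℝ,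
      (∀ i, d i ∈ spectrum ℝ A) ∧ A = U * realDiagonal d * Uᴴ ∧
        ∀ f : ℝ → ℝ, cfc f A = U * realDiagonal (f ∘ d) * Uᴴ :=
  ⟨hA.eigenvectorUnitary, hA.eigenvectorUnitary.2, hA.eigenvalues,
    hA.eigenvalues_mem_spectrum_real, hA.spectral_theorem, fun f => hA.cfc_eq f⟩

lemma isHermitian_conj_realDiagonal (U : Matrix m m ℂ) (d : m → ℝ) :
    (U * realDiagonal d * Uᴴ).IsHermitian := by
  refine isHermitian_mul_mul_conjTranspose U ?_
  ext i j
  by_cases h : i = j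
  · simp [realDiagonal, h]
  · simp [realDiagonal, h, Ne.symm h]

/-- The functional calculus of a Hermitian matrix can be computed in any diagonalization. -/
lemma cfc_conj_realDiagonal {U : Matrix m m ℂ} (hU : U ∈ unitaryGroup m ℂ) (d : m → ℝ)
    (f : ℝ → ℝ) :
    cfc f (U * realDiagonal d * Uᴴ) = U * realDiagonal (f ∘ d) * Uᴴ := by
  obtain ⟨W, hW, e, -, he, hf⟩ := (isHermitian_conj_realDiagonal U d).exists_unitary_conj_realDiagonal
  rw [hf f]
  have hU' := conjTranspose_mul_of_mem_unitaryGroup hU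
  have hU'' := mul_conjTranspose_of_mem_unitaryGroup hU
  have hW' := conjTranspose_mul_of_mem_unitaryGroup hW
  have hW'' := mul_conjTranspose_of_mem_unitaryGroup hW
  have key : realDiagonal e * (Wᴴ * U) = (Wᴴ * U) * realDiagonal d := by
    calc realDiagonal e * (Wᴴ * U) = (Wᴴ * W) * realDiagonal e * (Wᴴ * U) := by rw [hW', one_mul]
      _ = Wᴴ * (W * realDiagonal e * Wᴴ) * U := by simp only [mul_assoc]
      _ = Wᴴ * (U * realDiagonal d * Uᴴ) * U := by rw [he]
      _ = Wᴴ * U * realDiagonal d * (Uᴴ * U) := by simp only [mul_assoc]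
      _ = _ := by rw [hU', mul_one]
  -- Where the (i, j) entry of WᴴU is nonzero, `key` forces e i = d j, so the intertwining relation
  -- survives applying f.
  have key' : realDiagonal (f ∘ e) * (Wᴴ * U) = (Wᴴ * U) * realDiagonal (f ∘ d) := by
    ext i j
    have h := congrFun (congrFun key i) j
    simp only [realDiagonal, diagonal_mul, mul_diagonal, Function.comp_apply] at h ⊢
    by_cases hz : (Wᴴ * U) i j = 0
    · simp [hz]
    · rw [mul_comm] at h
      have : e i = d j := by exact_mod_cast mul_left_cancel₀ hz h
      rw [this, mul_comm]
  calc W * realDiagonal (f ∘ e) * Wᴴ = W * realDiagonal (f ∘ e) * Wᴴ * (U * Uᴴ) := by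
        rw [hU'', mul_one]
    _ = W * (realDiagonal (f ∘ e) * (Wᴴ * U)) * Uᴴ := by simp only [mul_assoc]
    _ = (W * Wᴴ) * U * realDiagonal (f ∘ d) * Uᴴ := by rw [key']; simp only [mul_assoc]
    _ = _ := by rw [hW'', one_mul]

/-- The functional calculus acts blockwise on block diagonal Hermitian matrices, and the spectrum
of such a matrix consists of eigenvalues of the blocks. -/
lemma exists_unitary_conj_realDiagonal_fromBlocks {l : Type*} [Fintype l] [DecidableEq l]
    {A : Matrix m m ℂ} {B : Matrix l l ℂ} (hA : A.IsHermitian) (hB : B.IsHermitian) :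
    ∃ U ∈ unitaryGroup (m ⊕ l) ℂ, ∃ d : m ⊕ l → ℝ,
      (∀ i, d i ∈ spectrum ℝ A ∪ spectrum ℝ B) ∧
      fromBlocks A 0 0 B = U * realDiagonal d * Uᴴ ∧
        ∀ f : ℝ → ℝ, fromBlocks (cfc f A) 0 0 (cfc f B) = U * realDiagonal (f ∘ d) * Uᴴ := by
  obtain ⟨V, hV, d, hd, hAd, hAf⟩ := hA.exists_unitary_conj_realDiagonal
  obtain ⟨W, hW, e, he, hBe, hBf⟩ := hB.exists_unitary_conj_realDiagonal
  have block : ∀ (d' : m → ℝ) (e' : l → ℝ),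
      fromBlocks (V * realDiagonal d' * Vᴴ) 0 0 (W * realDiagonal e' * Wᴴ) =
        fromBlocks V 0 0 W * realDiagonal (Sum.elim d' e') * (fromBlocks V 0 0 W)ᴴ := by
    intro d' e'
    have : realDiagonal (Sum.elim d' e') = fromBlocks (realDiagonal d') 0 0 (realDiagonal e') := by
      simp only [realDiagonal, fromBlocks_diagonal]
      congr 1
      ext (i | i) <;> rfl
    rw [this, fromBlocks_conjTranspose, fromBlocks_multiply, fromBlocks_multiply]
    simp
  refine ⟨fromBlocks V 0 0 W, mem_unitaryGroup_of_conjTranspose_mul ?_, Sum.elim d e, ?_, ?_, ?_⟩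
  · rw [fromBlocks_conjTranspose, fromBlocks_multiply]
    simp [conjTranspose_mul_of_mem_unitaryGroup hV, conjTranspose_mul_of_mem_unitaryGroup hW]
  · rintro (i | i)
    · exact Or.inl (hd i)
    · exact Or.inr (he i)
  · rw [← block, ← hAd, ← hBe]
  · intro f
    rw [Sum.comp_elim, ← block, ← hAf, ← hBf]

/-! ### Permutations and doubly stochastic matrices -/

lemma exists_unitary_conj_realDiagonal_comp_perm (σ : Equiv.Perm m) :
    ∃ P ∈ unitaryGroup m ℂ, ∀ d : m → ℝ, realDiagonal (d ∘ σ) = P * realDiagonal d * Pᴴ := by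
  refine ⟨of fun i j => if σ i = j then 1 else 0, mem_unitaryGroup_iff.2 ?_, fun d => ?_⟩
  · ext i j
    simp [mul_apply, star_apply, one_apply, eq_comm]
  · ext i j
    by_cases h : i = j <;> simp [realDiagonal, mul_apply, diagonal_apply, h, eq_comm]

/-- A map `Z ↦ Kᴴ Z K + Lᴴ Z L` which is unital and trace preserving acts on eigenvalues by a
convex combination of permutations. -/
lemma exists_perm_weights_of_kraus_eq {K L : Matrix m m ℂ} (h : Kᴴ * K + Lᴴ * L = 1)
    (h' : K * Kᴴ + L * Lᴴ = 1) {d e : m → ℝ}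
    (hde : Kᴴ * realDiagonal d * K + Lᴴ * realDiagonal d * L = realDiagonal e) :
    ∃ w : Equiv.Perm m → ℝ, (∀ σ, 0 ≤ w σ) ∧ ∑ σ, w σ = 1 ∧ ∑ σ, w σ • (d ∘ σ) = e := by
  have entry : ∀ (M : Matrix m m ℂ) (c : m → ℝ) (i : m), (Mᴴ * realDiagonal c * M) i i =
      ((∑ j, Complex.normSq (M j i) * c j : ℝ) : ℂ) := by
    intro M c i
    simp only [realDiagonal, mul_apply, diagonal_apply, conjTranspose_apply]
    push_cast
    refine Finset.sum_congr rfl fun j _ => ?_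
    rw [Complex.normSq_eq_conj_mul_self]
    simp
    ring
  have one : realDiagonal (fun _ : m => 1) = 1 := by simp [realDiagonal]
  -- Row sums of S are the diagonal of KᴴK + LᴴL, column sums that of KKᴴ + LLᴴ; the diagonal of
  -- `hde` reads e = S d.
  let S : Matrix m m ℝ := of fun i j => Complex.normSq (K j i) + Complex.normSq (L j i)
  have hS : S ∈ doublyStochastic ℝ m := by
    refine mem_doublyStochastic_iff_sum.2 ⟨fun i j => ?_, fun i => ?_, fun j => ?_⟩
    · exact add_nonneg (Complex.normSq_nonneg _) (Complex.normSq_nonneg _)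
    · have := congrFun (congrFun h i) i
      rw [← mul_one Kᴴ, ← mul_one Lᴴ, ← one, add_apply, entry, entry, one, one_apply_eq] at this
      simp only [S, of_apply, Finset.sum_add_distrib]
      simp only [mul_one] at this
      exact_mod_cast this
    · have := congrFun (congrFun h' j) j
      have hK := entry Kᴴ (fun _ => 1) j
      have hL := entry Lᴴ (fun _ => 1) j
      rw [one, mul_one, conjTranspose_conjTranspose] at hK hL
      rw [add_apply, hK, hL, one_apply_eq] at this
      simp only [S, of_apply, Finset.sum_add_distrib]
      simp only [mul_one, conjTranspose_apply, Complex.star_def, Complex.normSq_conj] at this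
      exact_mod_cast this
  obtain ⟨w, hw, hw1, hwS⟩ := exists_eq_sum_perm_of_mem_doublyStochastic hS
  refine ⟨w, hw, hw1, ?_⟩
  ext i
  have he : e i = ∑ j, S i j * d j := by
    have := congrFun (congrFun hde i) i
    rw [add_apply, entry, entry, realDiagonal, diagonal_apply_eq] at this
    simp only [S, of_apply, add_mul, Finset.sum_add_distrib]
    exact_mod_cast this.symm
  rw [he, ← hwS]
  simp [sum_apply, Finset.sum_mul, Equiv.Perm.permMatrix, PEquiv.toMatrix_apply]
  rw [Finset.sum_comm]
  simp

end Matrix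

open Matrix

section

variable {m : Type*} [Fintype m] [DecidableEq m]

/-! ### Antinorms and norms of diagonal matrices -/

namespace IsSymmetricAntinorm

variable {N : Matrix m m ℂ → ℝ}

/-- Split e = d + (e - d): the second summand contributes a nonnegative amount. -/
lemma mono_realDiagonal (hN : IsSymmetricAntinorm N) {d e : m → ℝ} (hd : ∀ i, 0 ≤ d i)
    (hde : ∀ i, d i ≤ e i) : N (realDiagonal d) ≤ N (realDiagonal e) := by
  have hsub : (realDiagonal (e - d)).PosSemidef :=
    realDiagonal_posSemidef fun i => sub_nonneg.2 (hde i)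
  have := hN.superadditive _ _ (realDiagonal_posSemidef hd) hsub
  rw [← realDiagonal_add, add_sub_cancel] at this
  linarith [hN.nonneg _ hsub]

lemma sum_le (hN : IsSymmetricAntinorm N) {ι : Type*} (s : Finset ι) {w : ι → ℝ}
    {d : ι → m → ℝ} (hw : ∀ k ∈ s, 0 ≤ w k) (hd : ∀ k ∈ s, ∀ i, 0 ≤ d k i) :
    ∑ k ∈ s, w k * N (realDiagonal (d k)) ≤ N (realDiagonal (∑ k ∈ s, w k • d k)) := by
  classical
  induction s using Finset.induction_on with
  | empty => simpa using hN.nonneg _ (realDiagonal_posSemidef (d := 0) fun _ => le_rfl)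
  | insert k s hk ih =>
    rw [Finset.sum_insert hk, Finset.sum_insert hk, realDiagonal_add]
    have hk' := hd k (Finset.mem_insert_self k s)
    have hwk := hw k (Finset.mem_insert_self k s)
    have ih' := ih (fun j hj => hw j (Finset.mem_insert_of_mem hj))
      (fun j hj => hd j (Finset.mem_insert_of_mem hj))
    refine le_trans ?_ (hN.superadditive _ _ (realDiagonal_posSemidef fun i => ?_)
      (realDiagonal_posSemidef fun i => ?_))
    · rw [realDiagonal_smul, hN.homogeneous _ _ hwk (realDiagonal_posSemidef hk')]
      linarith
    · exact mul_nonneg hwk (hk' i)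
    · rw [Finset.sum_apply]
      exact Finset.sum_nonneg fun j hj => mul_nonneg (hw j (Finset.mem_insert_of_mem hj))
        (hd j (Finset.mem_insert_of_mem hj) i)

lemma comp_perm (hN : IsSymmetricAntinorm N) {d : m → ℝ} (hd : ∀ i, 0 ≤ d i)
    (σ : Equiv.Perm m) : N (realDiagonal (d ∘ σ)) = N (realDiagonal d) := by
  obtain ⟨P, hP, h⟩ := exists_unitary_conj_realDiagonal_comp_perm σ
  rw [h, hN.unitarily_invariant _ (realDiagonal_posSemidef hd) P hP]

end IsSymmetricAntinorm

namespace IsSymmetricNorm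

variable {p : Seminorm ℂ (Matrix m m ℂ)}

lemma conj (hp : IsSymmetricNorm p) {U : Matrix m m ℂ} (hU : U ∈ unitaryGroup m ℂ)
    (A : Matrix m m ℂ) : p (U * A * Uᴴ) = p A :=
  hp.unitarily_invariant A U hU _ (conjTranspose_mem_unitaryGroup hU)

/-- Monotonicity holds since a diagonal contraction is the average of a diagonal unitary and its
adjoint. -/
lemma mono_realDiagonal (hp : IsSymmetricNorm p) {d e : m → ℝ} (hd : ∀ i, 0 ≤ d i)
    (hde : ∀ i, d i ≤ e i) : p (realDiagonal d) ≤ p (realDiagonal e) := by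
  -- If e i = 0 then d i = 0 too, so the value of the quotient is immaterial.
  let θ : m → ℝ := fun i => Real.arccos (d i / e i)
  have hcos : ∀ i, Real.cos (θ i) * e i = d i := by
    intro i
    have he : 0 ≤ e i := (hd i).trans (hde i)
    rw [Real.cos_arccos (by linarith [div_nonneg (hd i) he]) (div_le_one_of_le₀ (hde i) he)]
    rcases he.eq_or_lt with h | h
    · have := hde i
      have := hd i
      rw [← h, mul_zero]
      linarith
    · exact div_mul_cancel₀ _ h.ne'
  let V : (m → ℝ) → Matrix m m ℂ := fun φ => diagonal fun i => Complex.exp (φ i * Complex.I)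
  have hV : ∀ φ, V φ ∈ unitaryGroup m ℂ := by
    intro φ
    refine mem_unitaryGroup_iff'.2 ?_
    simp only [V, star_eq_conjTranspose, diagonal_conjTranspose, diagonal_mul_diagonal,
      ← diagonal_one]
    congr 1
    ext i
    simp [← Complex.exp_conj, ← Complex.exp_add]
  have hinv : ∀ φ, p (V φ * realDiagonal e) = p (realDiagonal e) := fun φ => by
    simpa using hp.unitarily_invariant (realDiagonal e) (V φ) (hV φ) 1 (one_mem _)
  have hsum : realDiagonal d =
      (1 / 2 : ℂ) • (V θ * realDiagonal e) + (1 / 2 : ℂ) • (V (-θ) * realDiagonal e) := by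
    simp only [V, realDiagonal, diagonal_mul_diagonal, ← diagonal_smul, diagonal_add]
    congr 1
    ext i
    rw [← hcos i]
    push_cast
    rw [Complex.cos]
    simp
    ring
  rw [hsum]
  refine (map_add_le_add p _ _).trans ?_
  rw [map_smul_eq_mul, map_smul_eq_mul, hinv, hinv]
  norm_num
  linarith

lemma comp_perm (hp : IsSymmetricNorm p) (d : m → ℝ) (σ : Equiv.Perm m) :
    p (realDiagonal (d ∘ σ)) = p (realDiagonal d) := by
  obtain ⟨P, hP, h⟩ := exists_unitary_conj_realDiagonal_comp_perm σ
  rw [h, hp.conj hP]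

end IsSymmetricNorm

/-- The Hermitian matrix `Kᴴ Z K + Lᴴ Z L`, where `Z` and this matrix are diagonalized, has
eigenvalues which are convex combinations of permutations of those of `Z`. -/
lemma exists_perm_weights_of_kraus_conj_eq {K L U V : Matrix m m ℂ} (h : Kᴴ * K + Lᴴ * L = 1)
    (h' : K * Kᴴ + L * Lᴴ = 1) (hU : U ∈ unitaryGroup m ℂ) (hV : V ∈ unitaryGroup m ℂ)
    {d e : m → ℝ}
    (hde : Kᴴ * (U * realDiagonal d * Uᴴ) * K + Lᴴ * (U * realDiagonal d * Uᴴ) * L =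
      V * realDiagonal e * Vᴴ) :
    ∃ w : Equiv.Perm m → ℝ, (∀ σ, 0 ≤ w σ) ∧ ∑ σ, w σ = 1 ∧ ∑ σ, w σ • (d ∘ σ) = e := by
  have hU' := conjTranspose_mul_of_mem_unitaryGroup hU
  have hU'' := mul_conjTranspose_of_mem_unitaryGroup hU
  have hV' := conjTranspose_mul_of_mem_unitaryGroup hV
  have hV'' := mul_conjTranspose_of_mem_unitaryGroup hV
  -- Passing to the eigenbases U and V preserves both normalizations.
  refine exists_perm_weights_of_kraus_eq (K := Uᴴ * K * V) (L := Uᴴ * L * V) ?_ ?_ ?_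
  · calc (Uᴴ * K * V)ᴴ * (Uᴴ * K * V) + (Uᴴ * L * V)ᴴ * (Uᴴ * L * V)
        = Vᴴ * (Kᴴ * (U * Uᴴ) * K + Lᴴ * (U * Uᴴ) * L) * V := by
          simp only [conjTranspose_mul, conjTranspose_conjTranspose, mul_add, add_mul, mul_assoc]
      _ = 1 := by rw [hU'', mul_one, mul_one, h, mul_one, hV']
  · calc (Uᴴ * K * V) * (Uᴴ * K * V)ᴴ + (Uᴴ * L * V) * (Uᴴ * L * V)ᴴ
        = Uᴴ * (K * (V * Vᴴ) * Kᴴ + L * (V * Vᴴ) * Lᴴ) * U := by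
          simp only [conjTranspose_mul, conjTranspose_conjTranspose, mul_add, add_mul, mul_assoc]
      _ = 1 := by rw [hV'', mul_one, mul_one, h', mul_one, hU']
  · calc (Uᴴ * K * V)ᴴ * realDiagonal d * (Uᴴ * K * V) +
          (Uᴴ * L * V)ᴴ * realDiagonal d * (Uᴴ * L * V)
        = Vᴴ * (Kᴴ * (U * realDiagonal d * Uᴴ) * K + Lᴴ * (U * realDiagonal d * Uᴴ) * L) * V := by
          simp only [conjTranspose_mul, conjTranspose_conjTranspose, mul_add, add_mul, mul_assoc]
      _ = (Vᴴ * V) * realDiagonal e * (Vᴴ * V) := by rw [hde]; simp only [mul_assoc]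
      _ = realDiagonal e := by rw [hV', one_mul, mul_one]

/-! ### Jensen's inequality over permutations -/

lemma sum_perm_smul_mem_Icc {a b : ℝ} {w : Equiv.Perm m → ℝ} {d : m → ℝ} (hw : ∀ σ, 0 ≤ w σ)
    (hw1 : ∑ σ, w σ = 1) (hd : ∀ i, d i ∈ Set.Icc a b) (i : m) :
    (∑ σ, w σ • (d ∘ σ)) i ∈ Set.Icc a b := by
  rw [Finset.sum_apply]
  exact (convex_Icc a b).sum_mem (fun σ _ => hw σ) hw1 fun σ _ => hd (σ i)

lemma IsSymmetricAntinorm.le_of_concaveOn {N : Matrix m m ℂ → ℝ} (hN : IsSymmetricAntinorm N)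
    {a b : ℝ} {f : ℝ → ℝ} (hf : ∀ t ∈ Set.Icc a b, 0 ≤ f t) (hc : ConcaveOn ℝ (Set.Icc a b) f)
    {w : Equiv.Perm m → ℝ} {d : m → ℝ} (hw : ∀ σ, 0 ≤ w σ) (hw1 : ∑ σ, w σ = 1)
    (hd : ∀ i, d i ∈ Set.Icc a b) :
    N (realDiagonal (f ∘ d)) ≤ N (realDiagonal (f ∘ ∑ σ, w σ • (d ∘ σ))) := by
  have hfd : ∀ i, 0 ≤ (f ∘ d) i := fun i => hf _ (hd i)
  calc N (realDiagonal (f ∘ d)) = ∑ σ, w σ * N (realDiagonal ((f ∘ d) ∘ σ)) := by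
        simp only [hN.comp_perm hfd, ← Finset.sum_mul, hw1, one_mul]
    _ ≤ N (realDiagonal (∑ σ, w σ • ((f ∘ d) ∘ σ))) :=
        hN.sum_le _ (fun σ _ => hw σ) fun σ _ i => hfd (σ i)
    _ ≤ _ := by
        refine hN.mono_realDiagonal (fun i => ?_) fun i => ?_
        · rw [Finset.sum_apply]
          exact Finset.sum_nonneg fun σ _ => mul_nonneg (hw σ) (hfd (σ i))
        · simp only [Function.comp_apply, Finset.sum_apply, Pi.smul_apply]
          exact hc.le_map_sum (fun σ _ => hw σ) hw1 fun σ _ => hd (σ i)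

lemma IsSymmetricNorm.le_of_convexOn {p : Seminorm ℂ (Matrix m m ℂ)} (hp : IsSymmetricNorm p)
    {a b : ℝ} {g : ℝ → ℝ} (hg : ∀ t ∈ Set.Icc a b, 0 ≤ g t) (hc : ConvexOn ℝ (Set.Icc a b) g)
    {w : Equiv.Perm m → ℝ} {d : m → ℝ} (hw : ∀ σ, 0 ≤ w σ) (hw1 : ∑ σ, w σ = 1)
    (hd : ∀ i, d i ∈ Set.Icc a b) :
    p (realDiagonal (g ∘ ∑ σ, w σ • (d ∘ σ))) ≤ p (realDiagonal (g ∘ d)) := by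
  calc p (realDiagonal (g ∘ ∑ σ, w σ • (d ∘ σ)))
      ≤ p (realDiagonal (∑ σ, w σ • ((g ∘ d) ∘ σ))) := by
        refine hp.mono_realDiagonal (fun i => ?_) fun i => ?_
        -- Monotonicity needs the smaller diagonal nonnegative, hence the averaged points must stay
        -- in [a, b].
        · exact hg _ (sum_perm_smul_mem_Icc hw hw1 hd i)
        · simp only [Function.comp_apply, Finset.sum_apply, Pi.smul_apply]
          exact hc.map_sum_le (fun σ _ => hw σ) hw1 fun σ _ => hd (σ i)
    _ ≤ ∑ σ, w σ * p (realDiagonal ((g ∘ d) ∘ σ)) := by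
        simp only [realDiagonal_sum, realDiagonal_smul]
        exact p.convexOn.map_sum_le (fun σ _ => hw σ) hw1 fun σ _ => Set.mem_univ _
    _ = p (realDiagonal (g ∘ d)) := by
        simp only [hp.comp_perm, ← Finset.sum_mul, hw1, one_mul]

end

theorem corollary3p5 (n : ℕ) (a b : ℝ) (f g : ℝ → ℝ)
    (hf : ∀ t ∈ Set.Icc a b, 0 ≤ f t) (hg : ∀ t ∈ Set.Icc a b, 0 ≤ g t)
    (A B X Y : Matrix (Fin n) (Fin n) ℂ)
    (hA : A.IsHermitian) (hB : B.IsHermitian)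
    (hAs : spectrum ℝ A ⊆ Set.Icc a b) (hBs : spectrum ℝ B ⊆ Set.Icc a b)
    (hXY : Xᴴ * X + Yᴴ * Y = 1) (hXY' : X * Xᴴ + Y * Yᴴ = 1) :
    (ConcaveOn ℝ (Set.Icc a b) f →
      ∀ N : Matrix (Fin n ⊕ Fin n) (Fin n ⊕ Fin n) ℂ → ℝ, IsSymmetricAntinorm N →
        N (cfc f (Matrix.fromBlocks A 0 0 B)) ≤
          N (Matrix.fromBlocks (cfc f (Xᴴ * A * X + Yᴴ * B * Y)) 0
            0 (cfc f (Yᴴ * A * Y + Xᴴ * B * X)))) ∧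
    (ConvexOn ℝ (Set.Icc a b) g →
      ∀ p : Seminorm ℂ (Matrix (Fin n ⊕ Fin n) (Fin n ⊕ Fin n) ℂ), IsSymmetricNorm p →
        p (Matrix.fromBlocks (cfc g (Xᴴ * A * X + Yᴴ * B * Y)) 0
            0 (cfc g (Yᴴ * A * Y + Xᴴ * B * X))) ≤
          p (cfc g (Matrix.fromBlocks A 0 0 B))) := by
  obtain ⟨U, hU, d, hd, hUd, -⟩ := exists_unitary_conj_realDiagonal_fromBlocks hA hB
  have hP : (Xᴴ * A * X + Yᴴ * B * Y).IsHermitian :=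
    (isHermitian_conjTranspose_mul_mul X hA).add (isHermitian_conjTranspose_mul_mul Y hB)
  have hQ : (Yᴴ * A * Y + Xᴴ * B * X).IsHermitian :=
    (isHermitian_conjTranspose_mul_mul Y hA).add (isHermitian_conjTranspose_mul_mul X hB)
  obtain ⟨V, hV, e, -, hVe, hVf⟩ := exists_unitary_conj_realDiagonal_fromBlocks hP hQ
  have hd' : ∀ i, d i ∈ Set.Icc a b := fun i => (Set.union_subset hAs hBs) (hd i)
  obtain ⟨w, hw, hw1, rfl⟩ := exists_perm_weights_of_kraus_conj_eq
    (K := fromBlocks X 0 0 X) (L := fromBlocks 0 Y Y 0) (U := U) (V := V) (d := d) (e := e)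
    (by simp [fromBlocks_conjTranspose, fromBlocks_multiply, fromBlocks_add, hXY])
    (by simp [fromBlocks_conjTranspose, fromBlocks_multiply, fromBlocks_add, hXY']) hU hV
    (by
      rw [← hUd, ← hVe]
      simp [fromBlocks_conjTranspose, fromBlocks_multiply, fromBlocks_add, add_comm])
  refine ⟨fun hc N hN => ?_, fun hc p hp => ?_⟩
  · have hfd : ∀ i, 0 ≤ (f ∘ d) i := fun i => hf _ (hd' i)
    have hfe : ∀ i, 0 ≤ (f ∘ ∑ σ, w σ • (d ∘ σ)) i := fun i =>
      hf _ (sum_perm_smul_mem_Icc hw hw1 hd' i)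
    rw [hVf, hUd, cfc_conj_realDiagonal hU,
      hN.unitarily_invariant _ (realDiagonal_posSemidef hfd) U hU,
      hN.unitarily_invariant _ (realDiagonal_posSemidef hfe) V hV]
    exact hN.le_of_concaveOn hf hc hw hw1 hd'
  · rw [hVf, hUd, cfc_conj_realDiagonal hU, hp.conj hU, hp.conj hV]
    exact hp.le_of_convexOn hg hc hw hw1 hd'
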